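/- Let $F$ be an ordered field and let $I\subseteq F$ be an integer part of $F$, i.e. a subring with no element strictly between $0$ and $1$ such that every $x\in F$ satisfies $a\le x<a+1$ for some $a\in I$. Let $\mathrm{Frac}(I)\subseteq F$ be the fraction field of $I$. An $E_1$-formula is a formula $\exists \bar z\,\bigl(\bigwedge_i 0\le z_i\le t(\bar x)\;\wedge\;\theta(\bar x,\bar z)\bigr)$ with $\theta$ a quantifier-free formula and $t$ a term of the language $\{+,-,\cdot,0,1,\le\}$ of ordered rings. We write $I\models IE_1$ if the ordered ring $I$ has no element strictly between $0$ and $1$ and, for every $E_1$-formula $\varphi(\bar x,y)$, $$I\models\forall\bar x\,\Bigl(\varphi(\bar x,0)\wedge\forall y\ge 0\,\bigl(\varphi(\bar x,y)\to\varphi(\bar x,y+1)\bigr)\;\to\;\forall y\ge 0\;\varphi(\bar x,y)\Bigr).$$ Square roots of positive elements of $F$ are taken in an arbitrary ordered field extending $F$ that contains them (for example $F$ itself when they lie there, or the real closure of $F$); the choice of the extension does not matter. **Theorem.** Suppose that $I\models IE_1$ and $\alpha\in F\setminus\mathrm{Frac}(I)$. 1. For every $\tau\in F$ with $\tau>0$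 and every $Q\in I$ with $Q>0$ there are $h,k\in I$ with $k>Q$ and $$-\frac{1}{\sqrt{1+4\tau}\,k^2}<\alpha-\frac hk<\frac{\tau}{\sqrt{1+4\tau}\,k^2}.$$ 2. (Hurwitz) For every $Q\in I$ with $Q>0$ there are $p,q\in I$ with $q>Q$, $p$ and $q$ coprime in $I$ (that is, $rp+sq=1$ for some $r,s\in I$), and $$\left|\frac pq-\alpha\right|<\frac{1}{\sqrt5\,q^2}.$$ -/

import Mathlib

open FirstOrder

/-- The first-order language `{+, -, ·, 0, 1, ≤}` of ordered rings. -/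
abbrev orderedRingLang : Language := Language.ring.sum Language.order

/-- An ordered ring as a structure for the language of ordered rings, every symbol having its
usual meaning. -/
@[reducible] noncomputable def orderedRingStructure (R : Type*) [CommRing R] [LinearOrder R] :
    orderedRingLang.Structure R :=
  letI := Ring.compatibleRingOfRing R
  letI := Language.orderStructure R
  Language.sumStructure Language.ring Language.order R

/-- The constant term `0` of the language of ordered rings. -/
def zeroTerm (β : Type*) : orderedRingLang.Term β :=
  Language.LHom.sumInl.onTerm (0 : Language.ring.Term β)

/-- The formula `∃ z₁, …, z_m (θ ∧ ⋀ᵢ (0 ≤ zᵢ ∧ zᵢ ≤ t))`, where the bound `t` is a term in the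
free variables only. -/
noncomputable def boundedExists {β : Type} {m : ℕ} (t : orderedRingLang.Term β)
    (θ : orderedRingLang.BoundedFormula β m) : orderedRingLang.Formula β :=
  (θ ⊓ Language.BoundedFormula.iInf (fun i : Fin m =>
    (zeroTerm (β ⊕ Fin m)).le (Language.Term.var (Sum.inr i)) ⊓
      (Language.Term.var (Sum.inr i)).le (t.relabel Sum.inl))).exs

/-- The `E₁`-formulas: a block of bounded existential quantifiers in front of an open
(quantifier-free) formula. -/
def IsE1 {β : Type} (φ : orderedRingLang.Formula β) : Prop :=
  ∃ (m : ℕ) (t : orderedRingLang.Term β) (θ : orderedRingLang.BoundedFormula β m),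
    θ.IsQF ∧ φ = boundedExists t θ

/-- `R` is discretely ordered: there is no element strictly between `0` and `1`. -/
def IsDiscretelyOrdered (R : Type*) [CommRing R] [LinearOrder R] : Prop :=
  ∀ x : R, ¬ (0 < x ∧ x < 1)

/-- The value of the formula `φ(y, x₁, …, x_n)` in the ordered ring `R`. -/
def HoldsAt {R : Type*} [CommRing R] [LinearOrder R] {n : ℕ}
    (φ : orderedRingLang.Formula (Fin (n + 1))) (x : Fin n → R) (y : R) : Prop :=
  letI := orderedRingStructure R
  φ.Realize (Fin.cons y x : Fin (n + 1) → R)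

/-- `R ⊨ IE₁`: the ordered ring `R` is discretely ordered and satisfies induction, with
parameters, over its nonnegative elements for all `E₁`-formulas. -/
def ModelsIE1 (R : Type*) [CommRing R] [LinearOrder R] [IsStrictOrderedRing R] : Prop :=
  IsDiscretelyOrdered R ∧
    ∀ (n : ℕ) (φ : orderedRingLang.Formula (Fin (n + 1))), IsE1 φ → ∀ x : Fin n → R,
      HoldsAt φ x 0 → (∀ y : R, 0 ≤ y → HoldsAt φ x y → HoldsAt φ x (y + 1)) →
        ∀ y : R, 0 ≤ y → HoldsAt φ x y

/-- The subring `I` is an integer part of the ordered field `F`. -/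
def IsIntegerPart {F : Type*} [Field F] [LinearOrder F] [IsStrictOrderedRing F]
    (I : Subring F) : Prop :=
  IsDiscretelyOrdered I ∧ ∀ x : F, ∃ a : I, (a : F) ≤ x ∧ x < a + 1

/-- The fraction field of the subring `I`, inside the field `F`. -/
def fracField {F : Type*} [Field F] (I : Subring F) : Subfield F :=
  Subfield.closure (I : Set F)

/-! Squeeze α between Farey neighbours a/b < α < c/d (bc − ad = 1) with large denominators and with
mediant below α. With C = c − dα, failure of the bound at c/d and at a/b gives P(1 − 2bC)² ≤ 1,
where P = 1 + 4τ; likewise P(1 − 2(b+d)C)² ≤ 1 from the mediant. These two numbers differ by 2dC,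
and P(2dC)² ≥ 4, so the parallelogram law forces their sum to vanish, which makes α rational
(`eq_one_of_not_isSegreApprox`).

`ModelsIE1` is needed only to find Farey neighbours (`ModelsIE1.exists_farey_pair`), by repeatedly
inserting mediants. As α cannot be a parameter of a formula over I, it is first replaced by a
fraction A/B that cuts the fractions of denominator at most Q in the same way
(`exists_fraction_same_cut`). -/

/-! ### Semantics of E₁-formulas -/

/-- A term of the language of rings, read in the language of ordered rings. -/
abbrev ringTerm {β : Type} (t : Language.ring.Term β) : orderedRingLang.Term β :=
  Language.LHom.sumInl.onTerm t

lemma realize_ringTerm {R : Type*} [CommRing R] [LinearOrder R] {β : Type}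
    (t : Language.ring.Term β) (v : β → R) :
    letI := orderedRingStructure R
    letI := Ring.compatibleRingOfRing R
    (ringTerm t).realize v = t.realize v := by
  let _ := Ring.compatibleRingOfRing R
  let _ := Language.orderStructure R
  exact Language.LHom.realize_onTerm _ _ _

lemma orderedStructure_orderedRingStructure (R : Type*) [CommRing R] [LinearOrder R] :
    letI := orderedRingStructure R
    orderedRingLang.OrderedStructure R := by
  let _ := Ring.compatibleRingOfRing R
  let _ := Language.orderStructure R
  exact ⟨fun _ => Iff.rfl⟩

lemma realize_ringTerm_le {R : Type*} [CommRing R] [LinearOrder R] {β : Type} {m : ℕ}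
    (t u : Language.ring.Term (β ⊕ Fin m)) (v : β → R) (z : Fin m → R) :
    letI := orderedRingStructure R
    letI := Ring.compatibleRingOfRing R
    ((ringTerm t).le (ringTerm u)).Realize v z ↔
      t.realize (Sum.elim v z) ≤ u.realize (Sum.elim v z) := by
  let _ := Ring.compatibleRingOfRing R
  let _ := Language.orderStructure R
  have := orderedStructure_orderedRingStructure R
  rw [Language.Term.realize_le]
  exact iff_of_eq (congrArg₂ _ (realize_ringTerm t _) (realize_ringTerm u _))

lemma realize_boundedExists {R : Type*} [CommRing R] [LinearOrder R] {β : Type} {m : ℕ}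
    (t : Language.ring.Term β) (θ : orderedRingLang.BoundedFormula β m) (v : β → R) :
    letI := orderedRingStructure R
    letI := Ring.compatibleRingOfRing R
    (boundedExists (ringTerm t) θ).Realize v ↔
      ∃ z : Fin m → R, θ.Realize v z ∧ ∀ i, 0 ≤ z i ∧ z i ≤ t.realize v := by
  let _ := Ring.compatibleRingOfRing R
  let _ := Language.orderStructure R
  have := orderedStructure_orderedRingStructure R
  unfold boundedExists
  rw [Language.BoundedFormula.realize_exs]
  refine exists_congr fun z => ?_
  rw [Language.BoundedFormula.realize_inf, Language.BoundedFormula.realize_iInf]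
  refine and_congr_right fun _ => forall_congr' fun i => ?_
  rw [Language.BoundedFormula.realize_inf, Language.Term.realize_le, Language.Term.realize_le]
  refine and_congr (iff_of_eq (congrArg₂ _ ?_ ?_)) (iff_of_eq (congrArg₂ _ ?_ ?_))
  · exact (realize_ringTerm (R := R) 0 _).trans (by simp)
  · simp
  · simp
  · rw [Language.Term.realize_relabel]
    exact realize_ringTerm t _

/-- The open formula `t ≤ u` for terms `t`, `u` of the language of rings. -/
noncomputable abbrev ringLe {β : Type} {m : ℕ} (t u : Language.ring.Term (β ⊕ Fin m)) :
    orderedRingLang.BoundedFormula β m :=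
  (ringTerm t).le (ringTerm u)

lemma isQF_ringLe {β : Type} {m : ℕ} (t u : Language.ring.Term (β ⊕ Fin m)) :
    (ringLe t u).IsQF :=
  (Language.BoundedFormula.IsAtomic.rel _ _).isQF

/-! ### Farey neighbours by E₁-induction -/

/-- The conditions, in `y, A, B, Q` and `a, b, c, d`, saying that `a/b ≤ A/B ≤ c/d` are Farey
neighbours in the unit interval with `y ≤ b + d`. -/
noncomputable def fareyMatrix : orderedRingLang.BoundedFormula (Fin 4) 4 :=
  let y : Language.ring.Term (Fin 4 ⊕ Fin 4) := Language.Term.var (Sum.inl 0)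
  let A : Language.ring.Term (Fin 4 ⊕ Fin 4) := Language.Term.var (Sum.inl 1)
  let B : Language.ring.Term (Fin 4 ⊕ Fin 4) := Language.Term.var (Sum.inl 2)
  let a : Language.ring.Term (Fin 4 ⊕ Fin 4) := Language.Term.var (Sum.inr 0)
  let b : Language.ring.Term (Fin 4 ⊕ Fin 4) := Language.Term.var (Sum.inr 1)
  let c : Language.ring.Term (Fin 4 ⊕ Fin 4) := Language.Term.var (Sum.inr 2)
  let d : Language.ring.Term (Fin 4 ⊕ Fin 4) := Language.Term.var (Sum.inr 3)
  ringLe y (b + d) ⊓ (ringLe (b * c) (a * d + 1) ⊓ (ringLe (a * d + 1) (b * c) ⊓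
    (ringLe (a * B) (b * A) ⊓ (ringLe (d * A) (c * B) ⊓ (ringLe a b ⊓ (ringLe c d ⊓
      (ringLe 1 b ⊓ ringLe 1 d)))))))

lemma isQF_fareyMatrix : fareyMatrix.IsQF := by
  unfold fareyMatrix
  repeat' apply Language.BoundedFormula.IsQF.inf
  all_goals exact isQF_ringLe _ _

lemma realize_fareyMatrix {R : Type*} [CommRing R] [LinearOrder R] (v z : Fin 4 → R) :
    letI := orderedRingStructure R
    fareyMatrix.Realize v z ↔ v 0 ≤ z 1 + z 3 ∧ z 1 * z 2 ≤ z 0 * z 3 + 1 ∧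
      z 0 * z 3 + 1 ≤ z 1 * z 2 ∧ z 0 * v 2 ≤ z 1 * v 1 ∧ z 3 * v 1 ≤ z 2 * v 2 ∧
      z 0 ≤ z 1 ∧ z 2 ≤ z 3 ∧ 1 ≤ z 1 ∧ 1 ≤ z 3 := by
  let _ := Ring.compatibleRingOfRing R
  let _ := Language.orderStructure R
  unfold fareyMatrix
  simp only [Language.BoundedFormula.realize_inf, realize_ringTerm_le]
  simp

/-- Bounded existential induction produces Farey neighbours `a/b ≤ A/B ≤ c/d` of order `Q`
around a fraction `A/B` in the unit interval. -/
lemma ModelsIE1.exists_farey_pair {R : Type*} [CommRing R] [LinearOrder R]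
    [IsStrictOrderedRing R] (hR : ModelsIE1 R) {A B Q : R} (hQ : 1 ≤ Q) (hA : 0 ≤ A)
    (hAB : A ≤ B) :
    ∃ a b c d : R, b * c - a * d = 1 ∧ a * B ≤ b * A ∧ d * A ≤ c * B ∧
      0 < b ∧ b ≤ Q ∧ 0 < d ∧ d ≤ Q ∧ Q < b + d := by
  -- If no pair has b, d ≤ Q < b + d, every pair within the bounds has b + d ≤ Q, so the induction
  -- step never gets stuck.
  by_contra hcon
  -- Variable 3 is Q. In the unit interval a ≤ b and c ≤ d, so one bound Q serves numerators and
  -- denominators.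
  have hφ : ∀ y : R, HoldsAt (boundedExists (ringTerm (Language.Term.var 3)) fareyMatrix)
      ![A, B, Q] y ↔ ∃ z : Fin 4 → R, (y ≤ z 1 + z 3 ∧ z 1 * z 2 ≤ z 0 * z 3 + 1 ∧
      z 0 * z 3 + 1 ≤ z 1 * z 2 ∧ z 0 * B ≤ z 1 * A ∧ z 3 * A ≤ z 2 * B ∧
      z 0 ≤ z 1 ∧ z 2 ≤ z 3 ∧ 1 ≤ z 1 ∧ 1 ≤ z 3) ∧ ∀ i, 0 ≤ z i ∧ z i ≤ Q := by
    intro y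
    unfold HoldsAt
    rw [realize_boundedExists]
    refine exists_congr fun z => ?_
    rw [realize_fareyMatrix]
    exact Iff.rfl
  -- Start from 0/1 and 1/1; the value 2Q + 1 is out of reach when b, d ≤ Q.
  have hall := hR.2 3 _ ⟨4, _, _, isQF_fareyMatrix, rfl⟩ ![A, B, Q]
    ((hφ 0).2 ⟨![0, 1, 1, 1], by simp [hA, hAB], by
      simp [Fin.forall_fin_succ, hQ, zero_le_one.trans hQ]⟩) (fun y hy h => ?_)
    (Q + Q + 1) (by linarith)
  · obtain ⟨z, ⟨h, -⟩, hz⟩ := (hφ _).1 hall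
    linarith [(hz 1).2, (hz 3).2]
  · obtain ⟨z, ⟨h0, h1, h2, h3, h4, h5, h6, h7, h8⟩, hz⟩ := (hφ _).1 h
    have hb : 0 < z 1 := by linarith
    have hd : 0 < z 3 := by linarith
    have hle : z 1 + z 3 ≤ Q := not_lt.1 fun hlt => hcon ⟨z 0, z 1, z 2, z 3,
      by linarith, h3, h4, hb, (hz 1).2, hd, (hz 3).2, hlt⟩
    have z0 := (hz 0).1
    have z2 := (hz 2).1
    refine (hφ _).2 ?_
    -- The mediant replaces the endpoint on its side of A/B; b + d grows by at least 1 and the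
    -- determinant is unchanged.
    rcases le_total ((z 0 + z 2) * B) ((z 1 + z 3) * A) with hm | hm
    · refine ⟨![z 0 + z 2, z 1 + z 3, z 2, z 3], ?_, ?_⟩
      · simp only [Matrix.cons_val]
        refine ⟨?_, ?_, ?_, ?_, ?_, ?_, ?_, ?_, ?_⟩ <;> linarith
      · simp only [Fin.forall_fin_succ, Fin.forall_fin_zero]
        simp [Fin.succ]
        refine ⟨⟨?_, ?_⟩, ⟨?_, ?_⟩, ⟨?_, ?_⟩, ?_, ?_⟩ <;> linarith
    · refine ⟨![z 0, z 1, z 0 + z 2, z 1 + z 3], ?_, ?_⟩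
      · simp only [Matrix.cons_val]
        refine ⟨?_, ?_, ?_, ?_, ?_, ?_, ?_, ?_, ?_⟩ <;> linarith
      · simp only [Fin.forall_fin_succ, Fin.forall_fin_zero]
        simp [Fin.succ]
        refine ⟨⟨?_, ?_⟩, ⟨?_, ?_⟩, ⟨?_, ?_⟩, ?_, ?_⟩ <;> linarith

/-! ### Cuts by fractions of bounded denominator -/

section Arithmetic

lemma coe_mem_fracField {F : Type*} [Field F] {I : Subring F} (a : I) : (a : F) ∈ fracField I :=
  Subfield.subset_closure a.2

lemma coe_div_ne {F : Type*} [Field F] {I : Subring F} {α : F} (hα : α ∉ fracField I) (p q : I) :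
    (p : F) / q ≠ α := fun h =>
  hα (h ▸ div_mem (coe_mem_fracField p) (coe_mem_fracField q))

lemma one_le_of_pos {F : Type*} [Field F] [LinearOrder F] {I : Subring F} (hI : IsDiscretelyOrdered I) {x : I} (hx : 0 < x) :
    1 ≤ x :=
  not_lt.1 fun h => hI x ⟨hx, h⟩

variable {F : Type*} [Field F] [LinearOrder F] [IsStrictOrderedRing F]

lemma IsIntegerPart.exists_gt {I : Subring F} (hI : IsIntegerPart I) (x : F) :
    ∃ n : I, x < n := by
  obtain ⟨a, -, ha⟩ := hI.2 x
  exact ⟨a + 1, by simpa using ha⟩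

/-- Fractions whose denominators are bounded by `Q` stay away from an irrational element. -/
lemma exists_pos_le_abs_sub_div {I : Subring F} (hI : IsDiscretelyOrdered I) {α : F}
    (hα : α ∉ fracField I) {Q : I} (hQ : 0 < Q) :
    ∃ ε : F, 0 < ε ∧ ∀ p q : I, 0 < q → q ≤ Q → ε ≤ |α - p / q| := by
  have hQ' : (0 : F) < Q := hQ
  -- Distinct fractions with denominators at most Q are at least 1/Q² apart, so at most one comes
  -- within 1/(2Q²) of α; its distance then serves as ε.
  by_cases h : ∃ p q : I, 0 < q ∧ q ≤ Q ∧ |α - p / q| < 1 / (2 * Q ^ 2)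
  · obtain ⟨p, q, hq, hqQ, hpq⟩ := h
    have hpos : 0 < |α - p / q| := abs_pos.2 (sub_ne_zero.2 (coe_div_ne hα p q).symm)
    refine ⟨|α - p / q|, hpos, fun p' q' hq' hqQ' => ?_⟩
    have hq0 : (0 : F) < q := hq
    have hq0' : (0 : F) < q' := hq'
    have hqQF : (q : F) ≤ Q := hqQ
    have hqQF' : (q' : F) ≤ Q := hqQ'
    by_cases heq : p * q' - p' * q = 0
    · have : (p : F) * q' - p' * q = 0 := congrArg (Subtype.val) heq
      have : (p : F) / q = p' / q' := by
        rw [div_eq_div_iff hq0.ne' hq0'.ne']; linarith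
      rw [this]
    · have h1 : (1 : F) ≤ |(p : F) * q' - p' * q| := by
        have := one_le_of_pos hI (abs_pos.2 heq)
        rcases abs_cases (p * q' - p' * q) with ⟨h, -⟩ | ⟨h, -⟩ <;> rw [h] at this
        · exact le_trans (show (1 : F) ≤ (p : F) * q' - p' * q from this) (le_abs_self _)
        · exact le_trans (show (1 : F) ≤ -((p : F) * q' - p' * q) from this) (neg_le_abs _)
      have h2 : 1 / (Q : F) ^ 2 ≤ |(p : F) / q - p' / q'| := by
        rw [div_sub_div _ _ hq0.ne' hq0'.ne', abs_div, abs_of_pos (mul_pos hq0 hq0'),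
          mul_comm (q : F) p', sq]
        gcongr
      have h3 : |(p : F) / q - p' / q'| ≤ |α - p / q| + |α - p' / q'| := by
        rw [← abs_neg (α - p / q)]
        refine le_trans (le_of_eq ?_) (abs_add_le _ _)
        congr 1; ring
      have h4 : 1 / (2 * (Q : F) ^ 2) = 1 / (Q : F) ^ 2 / 2 := by field_simp
      linarith
  · push Not at h
    exact ⟨_, by positivity, h⟩

/-- Some fraction lies on the same side as `α` of all fractions with denominator at most `Q`. -/
lemma exists_fraction_same_cut {I : Subring F} (hI : IsIntegerPart I) {α : F}
    (hα : α ∉ fracField I) {Q : I} (hQ : 0 < Q) :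
    ∃ A B : I, ∀ p q : I, 0 < q → q ≤ Q →
      (p * B ≤ q * A ↔ (p : F) < q * α) ∧ (q * A ≤ p * B ↔ q * α < (p : F)) := by
  obtain ⟨ε, hε, h⟩ := exists_pos_le_abs_sub_div hI.1 hα hQ
  -- Then A/B lies in (α − ε, α], where no fraction of denominator at most Q can fall.
  obtain ⟨B, hB⟩ := hI.exists_gt (1 / ε)
  obtain ⟨A, hA1, hA2⟩ := hI.2 (α * B)
  have hB0 : (0 : F) < B := lt_trans (by positivity) hB
  have hBε : 1 < B * ε := by rwa [div_lt_iff₀ hε] at hB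
  refine ⟨A, B, fun p q hq hqQ => ?_⟩
  have hq0 : (0 : F) < q := hq
  have hne : (p : F) ≠ q * α := fun e => coe_div_ne hα p q (by rw [e]; field_simp)
  have hgap := h p q hq hqQ
  have key1 : (p : F) < q * α → (p : F) * B < q * A := by
    intro hlt
    have : (p : F) / q < α := by rw [div_lt_iff₀ hq0]; linarith
    rw [abs_of_pos (by linarith)] at hgap
    have h1 : (p : F) / q ≤ α - ε := by linarith
    rw [div_le_iff₀ hq0] at h1
    calc (p : F) * B ≤ (α - ε) * q * B := by gcongr
      _ = q * (α * B - B * ε) := by ring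
      _ < q * A := by gcongr; linarith
  have key2 : q * α < (p : F) → (q : F) * A < p * B := by
    intro hlt
    calc (q : F) * A ≤ q * (α * B) := by gcongr
      _ = q * α * B := by ring
      _ < p * B := by gcongr
  have c1 : p * B ≤ q * A ↔ (p : F) * B ≤ q * A := Iff.rfl
  have c2 : q * A ≤ p * B ↔ (q : F) * A ≤ p * B := Iff.rfl
  rw [c1, c2]
  rcases lt_or_gt_of_ne hne with hlt | hlt
  · have := key1 hlt
    exact ⟨iff_of_true this.le hlt, iff_of_false this.not_ge hlt.not_gt⟩
  · have := key2 hlt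
    exact ⟨iff_of_false this.not_ge hlt.not_gt, iff_of_true this.le hlt⟩

/-! ### The Segre inequalities without square roots -/

/-- The approximation property of Segre's theorem, with the square root eliminated. -/
def IsSegreApprox (τ α h k : F) : Prop :=
  (0 < α - h / k → (1 + 4 * τ) * (k ^ 2 * (α - h / k)) ^ 2 < τ ^ 2) ∧
    (α - h / k < 0 → (1 + 4 * τ) * (k ^ 2 * (α - h / k)) ^ 2 < 1)

lemma sq_mul_sub_div {F : Type*} [Field F] (α h : F) {k : F} (hk : k ≠ 0) :
    k ^ 2 * (α - h / k) = k * (k * α - h) := by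
  field_simp

lemma isSegreApprox_of_lt {τ α h k : F} (hk : 0 < k) (hlt : h < k * α)
    (hs : (1 + 4 * τ) * (k * (k * α - h)) ^ 2 < τ ^ 2) : IsSegreApprox τ α h k := by
  rw [← sq_mul_sub_div α h hk.ne'] at hs
  have : h / k < α := by rw [div_lt_iff₀ hk]; linarith
  exact ⟨fun _ => hs, fun h => absurd h (by linarith)⟩

lemma isSegreApprox_of_gt {τ α h k : F} (hk : 0 < k) (hlt : k * α < h)
    (hs : (1 + 4 * τ) * (k * (h - k * α)) ^ 2 < 1) : IsSegreApprox τ α h k := by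
  have e : (k * (h - k * α)) ^ 2 = (k ^ 2 * (α - h / k)) ^ 2 := by
    rw [sq_mul_sub_div α h hk.ne']; ring
  rw [e] at hs
  have : α < h / k := by rw [lt_div_iff₀ hk]; linarith
  exact ⟨fun h => absurd h (by linarith), fun _ => hs⟩

/-- If `a/b < (a+c)/(b+d) < α < c/d` with `bc - ad = 1`, then one of the three fractions
is a good approximation of `α`, unless `α` is one explicit rational. -/
lemma eq_one_of_not_isSegreApprox {τ α a b c d : F} (hτ : 0 < τ) (hb : 0 < b) (hd : 0 < d)
    (hdet : b * c - a * d = 1) (ha : a < b * α) (hm : a + c < (b + d) * α) (hc : d * α < c)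
    (na : ¬ IsSegreApprox τ α a b) (nm : ¬ IsSegreApprox τ α (a + c) (b + d))
    (nc : ¬ IsSegreApprox τ α c d) : (c - d * α) * (d + 2 * b) = 1 := by
  have ha' := not_lt.1 fun h => na (isSegreApprox_of_lt hb ha h)
  have hm' := not_lt.1 fun h => nm (isSegreApprox_of_lt (add_pos hb hd) hm h)
  have hc' := not_lt.1 fun h => nc (isSegreApprox_of_gt hd hc h)
  set P := 1 + 4 * τ with hP
  have hP0 : 0 < P := by linarith
  set C := c - d * α with hC
  have hC0 : 0 < C := by linarith
  have hA : d * (b * α - a) = 1 - b * C := by rw [hC]; linear_combination hdet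
  have hM : d * ((b + d) * α - (a + c)) = 1 - (b + d) * C := by
    rw [hC]; linear_combination hdet
  -- Multiplying the failures on the two sides of α gives τ ≤ P·t(1 − t) with t = xC; now use 4t(1 −
  -- t) = 1 − (1 − 2t)².
  have key : ∀ x y : F, 0 < x → 0 < y → d * y = 1 - x * C → τ ^ 2 ≤ P * (x * y) ^ 2 →
      P * (1 - 2 * (x * C)) ^ 2 ≤ 1 := by
    intro x y hx hy hxy h
    have h1 : (τ) ^ 2 ≤ (P * ((x * y) * (d * C))) ^ 2 := by
      calc τ ^ 2 = τ ^ 2 * 1 := by ring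
        _ ≤ (P * (x * y) ^ 2) * (P * (d * C) ^ 2) := by gcongr
        _ = _ := by ring
    have h2 : τ ≤ P * ((x * y) * (d * C)) := le_of_sq_le_sq h1 (by positivity)
    have h3 : (1 - 2 * (x * C)) ^ 2 = 1 - 4 * ((x * y) * (d * C)) := by
      linear_combination (4 * x * C) * hxy
    rw [h3]
    linarith
  have e1 := key b _ hb (by linarith) hA ha'
  have e2 := key (b + d) _ (add_pos hb hd) (by linarith) hM hm'
  have e3 : P * ((1 - 2 * (b * C)) + (1 - 2 * ((b + d) * C))) ^ 2 ≤ 0 := by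
    have : ((1 - 2 * (b * C)) + (1 - 2 * ((b + d) * C))) ^ 2 =
      2 * (1 - 2 * (b * C)) ^ 2 + 2 * (1 - 2 * ((b + d) * C)) ^ 2 - 4 * (d * C) ^ 2 := by ring
    rw [this]
    linarith
  have e4 := pow_eq_zero_iff (two_ne_zero) |>.1
    (le_antisymm (nonpos_of_mul_nonpos_right e3 hP0) (sq_nonneg _))
  linarith

/-- Square roots can be reinstated in any extension containing them. -/
lemma IsSegreApprox.bounds {τ α h k : F} (hτ : 0 < τ) (hk : 0 < k)
    (H : IsSegreApprox τ α h k) {K : Type*} [Field K] [LinearOrder K] [IsStrictOrderedRing K]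
    (ι : F →+*o K) {s : K} (hs : 0 ≤ s) (hs2 : s ^ 2 = ι (1 + 4 * τ)) :
    -(1 / (s * ι k ^ 2)) < ι (α - h / k) ∧ ι (α - h / k) < ι τ / (s * ι k ^ 2) := by
  have hmono : StrictMono ι := (OrderHomClass.mono ι).strictMono_of_injective
    (RingHom.injective (ι : F →+* K))
  have hpos : ∀ {x : F}, 0 < x → 0 < ι x := fun {x} hx => by
    have := hmono hx; rwa [map_zero] at this
  have hk' := hpos hk
  have hτ' := hpos hτ
  have hs0 : 0 < s := by
    refine lt_of_le_of_ne hs fun h => ?_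
    have : (0 : K) < s ^ 2 := hs2 ▸ hpos (by linarith)
    rw [← h] at this
    simp at this
  have hD : 0 < s * ι k ^ 2 := by positivity
  set δ := α - h / k
  have hsq : ι ((1 + 4 * τ) * (k ^ 2 * δ) ^ 2) = (ι δ * (s * ι k ^ 2)) ^ 2 := by
    rw [map_mul, ← hs2, map_pow, map_mul, map_pow]; ring
  rw [neg_lt, ← neg_lt, lt_div_iff₀ hD, neg_lt, lt_div_iff₀ hD]
  rcases lt_trichotomy δ 0 with hδ | hδ | hδ
  · have hδ' : ι δ < 0 := by have := hmono hδ; rwa [map_zero] at this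
    have h1 := hmono (H.2 hδ)
    rw [hsq, map_one] at h1
    have hneg := mul_neg_of_neg_of_pos hδ' hD
    refine ⟨?_, hneg.trans hτ'⟩
    have h2 : (ι δ * (s * ι k ^ 2)) ^ 2 < 1 ^ 2 := by rwa [one_pow]
    rw [neg_mul]
    linarith [(abs_lt.1 (abs_lt_of_sq_lt_sq h2 zero_le_one)).1]
  · rw [hδ, map_zero]
    simpa using hτ'
  · have hδ' := hpos hδ
    have h1 := hmono (H.1 hδ)
    rw [hsq, map_pow] at h1
    refine ⟨?_, lt_of_pow_lt_pow_left₀ 2 hτ'.le h1⟩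
    rw [neg_mul]
    linarith [mul_pos hδ' hD]

end Arithmetic

/-! ### Farey neighbours of α and the conclusion -/

section Approximation

lemma sub_coe_notMem_fracField {F : Type*} [Field F] {I : Subring F} {α : F} (hα : α ∉ fracField I) (n : I) :
    α - n ∉ fracField I := fun h =>
  hα (by simpa using add_mem h (coe_mem_fracField n))

variable {F : Type*} [Field F] [LinearOrder F] [IsStrictOrderedRing F] {I : Subring F}

/-- Farey neighbours of order `Q` around an irrational element of the unit interval. -/
lemma exists_farey_pair_of_mem_Ioo (hI : IsIntegerPart I) (hIE : ModelsIE1 I) {α : F}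
    (hα : α ∉ fracField I) (h0 : 0 < α) (h1 : α < 1) {Q : I} (hQ : 0 < Q) :
    ∃ a b c d : I, b * c - a * d = 1 ∧ (a : F) < b * α ∧ d * α < (c : F) ∧
      0 < b ∧ 0 < d ∧ Q < b + d := by
  obtain ⟨A, B, h⟩ := exists_fraction_same_cut hI hα hQ
  have hQ1 := one_le_of_pos hI.1 hQ
  have hA : 0 ≤ A := by simpa [h0] using (h 0 1 zero_lt_one hQ1).1
  have hAB : A ≤ B := by simpa [h1] using (h 1 1 zero_lt_one hQ1).2
  obtain ⟨a, b, c, d, hdet, ha, hc, hb, hbQ, hd, hdQ, hbd⟩ := hIE.exists_farey_pair hQ1 hA hAB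
  exact ⟨a, b, c, d, hdet, (h a b hb hbQ).1.1 ha, (h c d hd hdQ).2.1 hc, hb, hd, hbd⟩

/-- Farey neighbours of order `Q` around an arbitrary irrational element. -/
lemma exists_farey_pair_around (hI : IsIntegerPart I) (hIE : ModelsIE1 I) {α : F}
    (hα : α ∉ fracField I) {Q : I} (hQ : 0 < Q) :
    ∃ a b c d : I, b * c - a * d = 1 ∧ (a : F) < b * α ∧ d * α < (c : F) ∧
      0 < b ∧ 0 < d ∧ Q < b + d := by
  obtain ⟨n, hn1, hn2⟩ := hI.2 α
  have hne : (n : F) ≠ α := fun h => hα (h ▸ coe_mem_fracField n)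
  obtain ⟨a, b, c, d, hdet, ha, hc, hb, hd, hbd⟩ :=
    exists_farey_pair_of_mem_Ioo hI hIE (sub_coe_notMem_fracField hα n)
      (sub_pos.2 (lt_of_le_of_ne hn1 hne)) (by linarith) hQ
  refine ⟨a + n * b, b, c + n * d, d, by linear_combination hdet, ?_, ?_, hb, hd, hbd⟩ <;>
  · push_cast
    linarith

/-- If `b` is small then `d` is large, so that `a/b` would be too close to `α`. -/
lemma lt_of_abs_sub_div_lt {α ε a b d Q : F} (hb : 1 ≤ b) (hd : 0 < d)
    (hgap : b ≤ Q → ε ≤ |α - a / b|) (hsum : Q + 1 / ε < b + d) (hε : 0 < ε)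
    (habs : |b * α - a| * d < 1) : Q < b := by
  by_contra! hbQ
  have hb0 : 0 < b := by linarith
  have h1 : |b * α - a| = b * |α - a / b| := by
    rw [← abs_of_pos hb0, ← abs_mul, abs_of_pos hb0]
    congr 1
    field_simp
  have h2 : 1 / ε < d := by linarith
  rw [div_lt_iff₀ hε] at h2
  have h3 : 1 * ε * d ≤ b * |α - a / b| * d := by
    gcongr
    exact hgap hbQ
  rw [h1] at habs
  linarith

/-- There are Farey neighbours around `α` with both denominators large. -/
lemma exists_farey_pair_large (hI : IsIntegerPart I) (hIE : ModelsIE1 I) {α : F}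
    (hα : α ∉ fracField I) {Q : I} (hQ : 0 < Q) :
    ∃ a b c d : I, b * c - a * d = 1 ∧ (a : F) < b * α ∧ d * α < (c : F) ∧
      Q < b ∧ Q < d := by
  obtain ⟨ε, hε, hgap⟩ := exists_pos_le_abs_sub_div hI.1 hα hQ
  obtain ⟨N, hN⟩ := hI.exists_gt (Q + 1 / ε)
  have hQ' : (0 : F) < Q := hQ
  have hN0 : 0 < N := by
    have : (0 : F) < N := lt_trans (by positivity) hN
    exact this
  obtain ⟨a, b, c, d, hdet, ha, hc, hb, hd, hbd⟩ := exists_farey_pair_around hI hIE hα hN0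
  have hdet' : (b : F) * c - a * d = 1 := congrArg Subtype.val hdet
  have hbd' : (N : F) < b + d := hbd
  have hb1 : (1 : F) ≤ b := one_le_of_pos hI.1 hb
  have hd1 : (1 : F) ≤ d := one_le_of_pos hI.1 hd
  have hu : 0 < (b : F) * α - a := by linarith
  have hv : 0 < (c : F) - d * α := by linarith
  have hsum : ((b : F) * α - a) * d + (c - d * α) * b = 1 := by linear_combination hdet'
  have hu' : 0 < ((b : F) * α - a) * d := by positivity
  have hv' : 0 < ((c : F) - d * α) * b := by positivity
  refine ⟨a, b, c, d, hdet, ha, hc, ?_, ?_⟩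
  · have : (Q : F) < b := lt_of_abs_sub_div_lt (d := (d : F)) hb1 (by linarith) (hgap a b hb)
      (by linarith) hε (by rw [abs_of_pos hu]; linarith)
    exact this
  · have : (Q : F) < d := lt_of_abs_sub_div_lt (d := (b : F)) hd1 (by linarith) (hgap c d hd)
      (by linarith) hε (by rw [abs_sub_comm, abs_of_pos hv]; linarith)
    exact this

/-- There are Farey neighbours with large denominators whose mediant lies below `α`. -/
lemma exists_farey_pair_mediant_lt (hI : IsIntegerPart I) (hIE : ModelsIE1 I) {α : F}
    (hα : α ∉ fracField I) {Q : I} (hQ : 0 < Q) :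
    ∃ a b c d : I, b * c - a * d = 1 ∧ (a : F) < b * α ∧ d * α < (c : F) ∧
      Q < b ∧ Q < d ∧ (a + c : F) < (b + d) * α := by
  obtain ⟨a, b, c, d, hdet, ha, hc, hb, hd⟩ := exists_farey_pair_large hI hIE hα hQ
  have hu : 0 < (b : F) * α - a := by linarith
  -- Division with remainder: n is the number of mediant steps toward a/b that stay above α, so the
  -- next mediant falls below it.
  obtain ⟨n, hn1, hn2⟩ := hI.2 ((c - d * α) / (b * α - a))
  have hb0 : 0 < b := hQ.trans hb
  have hn : 0 ≤ n := by
    have h1 : (0 : F) < n + 1 := lt_trans (div_pos (by linarith) hu) hn2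
    have h2 : 1 ≤ n + 1 := one_le_of_pos hI.1 h1
    linarith
  have hd' : Q < d + n * b := by
    have := mul_nonneg hn hb0.le
    linarith
  rw [le_div_iff₀ hu] at hn1
  rw [div_lt_iff₀ hu] at hn2
  refine ⟨a, b, c + n * a, d + n * b, by linear_combination hdet, ha, ?_, hb, hd', ?_⟩
  · refine lt_of_le_of_ne (by push_cast; linarith) fun h => coe_div_ne hα (c + n * a)
      (d + n * b) ?_
    have : ((d + n * b : I) : F) ≠ 0 := fun h0 =>
      (hQ.trans hd').ne' (Subtype.ext h0)
    rw [← h]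
    field_simp
  · push_cast
    linarith

/-- Segre's theorem, with the square root eliminated and with coprime fractions. -/
theorem exists_isCoprime_isSegreApprox (hI : IsIntegerPart I) (hIE : ModelsIE1 I) {α : F}
    (hα : α ∉ fracField I) {τ : F} (hτ : 0 < τ) {Q : I} (hQ : 0 < Q) :
    ∃ h k : I, Q < k ∧ IsCoprime h k ∧ IsSegreApprox τ α (h : F) k := by
  obtain ⟨a, b, c, d, hdet, ha, hc, hb, hd, hm⟩ := exists_farey_pair_mediant_lt hI hIE hα hQ
  have hd0 := hQ.trans hd
  by_contra! hcon
  have na := hcon a b hb ⟨-d, c, by linear_combination hdet⟩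
  have nc := hcon c d hd ⟨b, -a, by linear_combination hdet⟩
  have nm := hcon (a + c) (b + d) (by linarith) ⟨b, -a, by linear_combination hdet⟩
  have hb' : (0 : F) < b := hQ.trans hb
  have hd' : (0 : F) < d := hd0
  have hdet' : (b : F) * c - a * d = 1 := congrArg Subtype.val hdet
  have := eq_one_of_not_isSegreApprox hτ hb' hd' hdet' ha hm hc na
    (by simpa using nm) nc
  -- Solving (c − dα)(d + 2b) = 1 for α exhibits it as a fraction.
  refine coe_div_ne hα (c * (d + b + b) - 1) (d * (d + b + b)) ?_
  push_cast
  rw [div_eq_iff (by positivity)]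
  linear_combination this

end Approximation

theorem mainTheorem4 {F : Type*} [Field F] [LinearOrder F] [IsStrictOrderedRing F]
    (I : Subring F) (hI : IsIntegerPart I) (hIE : ModelsIE1 I)
    (α : F) (hα : α ∉ fracField I) :
    (∀ τ : F, 0 < τ → ∀ Q : I, 0 < Q → ∃ h k : I, Q < k ∧
      ∀ (K : Type*) [Field K] [LinearOrder K] [IsStrictOrderedRing K] (ι : F →+*o K) (s : K),
        0 ≤ s → s ^ 2 = ι (1 + 4 * τ) →
          -(1 / (s * ι k ^ 2)) < ι (α - h / k) ∧ ι (α - h / k) < ι τ / (s * ι k ^ 2)) ∧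
    (∀ Q : I, 0 < Q → ∃ p q : I, Q < q ∧ IsCoprime p q ∧
      ∀ (K : Type*) [Field K] [LinearOrder K] [IsStrictOrderedRing K] (ι : F →+*o K) (s : K),
        0 ≤ s → s ^ 2 = 5 → |ι (p / q - α)| < 1 / (s * ι q ^ 2)) := by
  refine ⟨fun τ hτ Q hQ => ?_, fun Q hQ => ?_⟩
  · obtain ⟨h, k, hk, -, H⟩ := exists_isCoprime_isSegreApprox hI hIE hα hτ hQ
    exact ⟨h, k, hk, fun K _ _ _ ι s hs hs2 => H.bounds hτ (hQ.trans hk) ι hs hs2⟩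
  -- At τ = 1 both one-sided bounds become 1/(√5 q²).
  · obtain ⟨p, q, hq, hpq, H⟩ := exists_isCoprime_isSegreApprox hI hIE hα one_pos hQ
    refine ⟨p, q, hq, hpq, fun K _ _ _ ι s hs hs2 => ?_⟩
    have h5 : s ^ 2 = ι (1 + 4 * 1) := by
      rw [hs2, mul_one, map_add, map_one, map_ofNat]
      norm_num
    have hb := H.bounds one_pos (hQ.trans hq) ι hs h5
    rw [map_one] at hb
    rw [← neg_sub α, map_neg, abs_neg]
    exact abs_lt.2 hb
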